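/- Let $\theta:\mathbf R^n\to[-\infty,+\infty]$ be polyhedral, i.e. its epigraph $\operatorname{epi}\theta=\{(x,\alpha)\in\mathbf R^n\times\mathbf R : \theta(x)\le\alpha\}$ is a polyhedral convex set (a finite intersection of closed half-spaces), and let $\bar v\in\partial\theta(\bar x)$. Here, for a function $f:\mathbf R^n\to[-\infty,+\infty]$ and a point $x$ with $f(x)$ finite, $\partial f(x)$ is the limiting subdifferential, the set of all $v$ such that $(v,-1)$ is a limiting normal to $\operatorname{epi} f$ at $(x,f(x))$; it is empty where $f$ is not finite. The subderivative, the critical cone and the second subderivative are $$\mathrm df(x)(w)=\liminf_{t\searrow0,\;w'\to w}\frac{f(x+tw')-f(x)}{t},\qquad \mathcal C_f(x,v)=\{w : \langle v,w\rangle=\mathrm df(x)(w)\},$$ $$\mathrm d^2f(x,v)(w)=\liminf_{t\searrow0,\;u\to w}\frac{f(x+tu)-f(x)-t\langle v,u\rangle}{\tfrac12t^2}.$$ A proper function $\varphi$ is a generalized quadratic form (GQF) if $\operatorname{dom}\varphi=\{x : \varphi(x)<\infty\}$ is a linear subspace and $\varphi(x)=\langle Lx,x\rangle$ on $\operatorname{dom}\varphi$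 for some symmetric linear operator $L:\operatorname{dom}\varphi\to\mathbf R^n$. The quadratic bundle $\operatorname{quad}f(x,v)$ is the set of all GQFs $q$ for which there are $(x^k,v^k)\to(x,v)$ with $v^k\in\partial f(x^k)$ such that each $\mathrm d^2f(x^k,v^k)$ is a GQF and $\mathrm d^2f(x^k,v^k)$ epi-converges to $q$ (the epigraphs converge in the sense of Painlevé–Kuratowski). The indicator function $\delta_S$ of a set $S$ is $0$ on $S$ and $+\infty$ elsewhere. Put $\mathcal C=\mathcal C_\theta(\bar x,\bar v)$ and $\mathcal C-\mathcal C=\{w-w' : w,w'\in\mathcal C\}$. Then $$q(w)\ge\delta_{\mathcal C-\mathcal C}(w)\quad\text{for all } w\in\mathbf R^n\text{ and all } q\in\operatorname{quad}\theta(\bar x,\bar v),$$ and moreover $\delta_{\mathcal C-\mathcal C}\in\operatorname{quad}\theta(\bar x,\bar v)$. That is, $\delta_{\mathcal C-\mathcal C}$ is the least element of $\operatorname{quad}\theta(\bar x,\bar v)$ in the pointwise order. -/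

import Mathlib

open Filter Topology Pointwise

namespace VarAnalysis

/-- Outer limit (Painlevé–Kuratowski upper limit) of the sets `C i` along the filter `l`. In
first countable spaces, with `l` countably generated, its points are the limits of `x k ∈ C (i k)`
with `i k` tending to `l`. -/
def outerLimit {ι α : Type*} [TopologicalSpace α] (l : Filter ι) (C : ι → Set α) : Set α :=
  {x | ∀ U ∈ 𝓝 x, ∃ᶠ i in l, (C i ∩ U).Nonempty}

/-- Inner limit (Painlevé–Kuratowski lower limit) of the sets `C i` along the filter `l`. -/
def innerLimit {ι α : Type*} [TopologicalSpace α] (l : Filter ι) (C : ι → Set α) : Set α :=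
  {x | ∀ U ∈ 𝓝 x, ∀ᶠ i in l, (C i ∩ U).Nonempty}

variable {E : Type*} [NormedAddCommGroup E] [InnerProductSpace ℝ E]

/-- The epigraph of an extended-real-valued function. -/
def epi (f : E → EReal) : Set (E × ℝ) :=
  {p | f p.1 ≤ (p.2 : EReal)}

/-- The effective domain of an extended-real-valued function. -/
def effDom (f : E → EReal) : Set E :=
  {x | f x < ⊤}

/-- A proper function: nowhere `-∞` and not identically `+∞`. -/
def IsProper (f : E → EReal) : Prop :=
  (∀ x, ⊥ < f x) ∧ (effDom f).Nonempty

/-- The indicator function of a set: `0` on the set and `+∞` outside. -/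
noncomputable def indicatorFun (C : Set E) : E → EReal :=
  open Classical in fun x => if x ∈ C then 0 else ⊤

/-- A polyhedral function: its epigraph is a polyhedral convex set, that is, the intersection of
finitely many closed half-spaces. -/
def IsPolyhedralFun (f : E → EReal) : Prop :=
  ∃ (m : ℕ) (a : Fin m → E) (b c : Fin m → ℝ),
    epi f = {p | ∀ i, inner ℝ (a i) p.1 + b i * p.2 ≤ c i}

/-- The tangent (Bouligand contingent) cone to `Ω` at `p`: the outer limit of `(Ω - p) / t` as `t`
decreases to `0`. -/
def tangentCone (Ω : Set (E × ℝ)) (p : E × ℝ) : Set (E × ℝ) :=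
  outerLimit (𝓝[>] (0 : ℝ)) (fun t => {w | p + t • w ∈ Ω})

/-- The regular normal cone to `Ω` at `p`: the polar of the tangent cone with respect to the
canonical inner product of `E × ℝ`; empty if `p ∉ Ω`. -/
def regularNormalCone (Ω : Set (E × ℝ)) (p : E × ℝ) : Set (E × ℝ) :=
  {v | p ∈ Ω ∧ ∀ w ∈ tangentCone Ω p, inner ℝ v.1 w.1 + v.2 * w.2 ≤ 0}

/-- The limiting (Mordukhovich) normal cone. -/
def normalCone (Ω : Set (E × ℝ)) (p : E × ℝ) : Set (E × ℝ) :=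
  outerLimit (𝓝 p) (regularNormalCone Ω)

/-- The (limiting) subdifferential; empty where the function is not finite. -/
def subdifferential (f : E → EReal) (x : E) : Set E :=
  {v | f x ≠ ⊤ ∧ f x ≠ ⊥ ∧ (v, (-1 : ℝ)) ∈ normalCone (epi f) (x, (f x).toReal)}

/-- The subderivative `df(x)` (at a point where `f` is finite):
`df(x)(w) = liminf (f(x + t w') - f(x)) / t` as `t ↘ 0`, `w' → w`. -/
noncomputable def subderivative (f : E → EReal) (x : E) (w : E) : EReal :=
  liminf (fun s : ℝ × E => (f (x + s.1 • s.2) - f x) / (s.1 : EReal)) (𝓝[>] (0 : ℝ) ×ˢ 𝓝 w)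

/-- The critical cone of `f` at `x` for `v`. -/
def criticalCone (f : E → EReal) (x v : E) : Set E :=
  {w | ((inner ℝ v w : ℝ) : EReal) = subderivative f x w}

/-- The second-order difference quotient
`Δₜ²f(x,v)(u) = (f(x + t u) - f(x) - t ⟨v,u⟩) / (t² / 2)`. -/
noncomputable def secondDiffQuot (f : E → EReal) (x v : E) (t : ℝ) (u : E) : EReal :=
  (f (x + t • u) - f x - ((t * inner ℝ v u : ℝ) : EReal)) / ((t ^ 2 / 2 : ℝ) : EReal)

/-- The second subderivative `d²f(x,v)`:
`d²f(x,v)(w) = liminf Δₜ²f(x,v)(u)` as `t ↘ 0`, `u → w`. -/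
noncomputable def secondSubderivative (f : E → EReal) (x v : E) (w : E) : EReal :=
  liminf (fun s : ℝ × E => secondDiffQuot f x v s.1 s.2) (𝓝[>] (0 : ℝ) ×ˢ 𝓝 w)

/-- Epi-convergence of a sequence of functions: set convergence of the epigraphs. -/
def EpiConverges (f : ℕ → E → EReal) (g : E → EReal) : Prop :=
  innerLimit atTop (fun k => epi (f k)) = epi g ∧ outerLimit atTop (fun k => epi (f k)) = epi g

/-- A generalized quadratic form (GQF): a proper function whose effective domain is a linear
subspace `S`, given on `S` by `⟨L x, x⟩` for a symmetric linear `L : S → E`. -/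
def IsGQF (φ : E → EReal) : Prop :=
  IsProper φ ∧ ∃ S : Submodule ℝ E, effDom φ = (S : Set E) ∧
    ∃ L : S →ₗ[ℝ] E, (∀ x y : S, inner ℝ (L x) (y : E) = inner ℝ (x : E) (L y)) ∧
      ∀ x : S, φ (x : E) = ((inner ℝ (L x) (x : E) : ℝ) : EReal)

/-- The quadratic bundle of `f` at `x` for `v`: the GQFs that are epi-limits of second
subderivatives `d²f(xₖ,vₖ)` which are GQFs, along `(xₖ,vₖ) → (x,v)` in the graph of `∂f`. -/
def quadBundle (f : E → EReal) (x v : E) : Set (E → EReal) :=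
  {q | IsGQF q ∧ ∃ (xs vs : ℕ → E),
    (∀ k, vs k ∈ subdifferential f (xs k)) ∧
    (∀ k, IsGQF (secondSubderivative f (xs k) (vs k))) ∧
    Tendsto xs atTop (𝓝 x) ∧ Tendsto vs atTop (𝓝 v) ∧
    EpiConverges (fun k => secondSubderivative f (xs k) (vs k)) q}

end VarAnalysis
open VarAnalysis

/-!
The epigraph of a polyhedral function `θ` is a polyhedron `P`, and near each of its points `p` it
agrees with the translate by `p` of the cone of directions admissible for the constraints active
at `p` (`activeCone`). Hence the tangent cone to `P` at `p` is that cone, the limiting normal cone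
is its polar, and on the critical cone `θ` is locally affine, while off the critical cone its growth
exceeds the linear term at first order. So every second subderivative `d²θ(x, v)` is the indicator
of the critical cone at `(x, v)` (`secondSubderivative_eq_indicatorFun`), and everything reduces to
comparing critical cones at nearby points of the graph of the subdifferential. Lifted to
`E × ℝ`, a critical cone is the face of the tangent cone exposed by `(v, -1)`.

Two facts about exposed faces carry the argument.

* For `(p', ν')` near `(p, ν)`, with `p'` in `P` and `ν'` normal at `p'`, the face exposed by `ν'`
  at `p'` is contained in the span of the face exposed by `ν` at `p`
  (`eventually_exposedFace_subset_sub`). Indeed, the tangent cone at `p'` is the tangent cone at `p`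
  enlarged by multiples of `p - p'`, a direction on which `ν'` vanishes; and a cone given by
  finitely many inequalities has finitely many faces, so that a sequence of faces exposed by
  functionals tending to `ν` eventually lies in the face exposed by `ν`. Thus every epi-limit of
  second subderivatives is bounded below by the indicator of the span of the critical cone.
* If `p'` is reached from `p` by a small step into the relative interior of the face exposed by `ν`,
  then `ν` is still normal at `p'` and exposes there exactly the span of that face
  (`exists_eventually_exposedFace_eq_sub`). Along such points the second subderivative is constantly
  the indicator of the span, which is therefore attained in the quadratic bundle.
-/

namespace VarAnalysis

/-! ### Polyhedra, their active cones and exposed faces -/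

section Polyhedron

variable {ι F : Type*} [NormedAddCommGroup F] [NormedSpace ℝ F]

/-- The polyhedron cut out by the inequalities `A i p ≤ c i`. -/
def polyhedron (A : ι → F →L[ℝ] ℝ) (c : ι → ℝ) : Set F :=
  {p | ∀ i, A i p ≤ c i}

/-- The cone of directions that satisfy the linear parts of the constraints active at `p`. It is
the tangent cone to the polyhedron when `p` belongs to it. -/
def activeCone (A : ι → F →L[ℝ] ℝ) (c : ι → ℝ) (p : F) : Set F :=
  {w | ∀ i, A i p = c i → A i w ≤ 0}

/-- The part of the active cone on which the functional `ν` vanishes. It is a face of that cone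
when `ν` is nonpositive on it. -/
def exposedFace (A : ι → F →L[ℝ] ℝ) (c : ι → ℝ) (p : F) (ν : F →L[ℝ] ℝ) : Set F :=
  {w | w ∈ activeCone A c p ∧ ν w = 0}

variable {A : ι → F →L[ℝ] ℝ} {c : ι → ℝ} {p : F} {ν : F →L[ℝ] ℝ}

theorem zero_mem_exposedFace : (0 : F) ∈ exposedFace A c p ν :=
  ⟨fun i _ => by simp, by simp⟩

theorem add_mem_exposedFace {w z : F} (hw : w ∈ exposedFace A c p ν)
    (hz : z ∈ exposedFace A c p ν) : w + z ∈ exposedFace A c p ν := by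
  refine ⟨fun i hi => ?_, ?_⟩
  · rw [map_add]
    exact add_nonpos (hw.1 i hi) (hz.1 i hi)
  · rw [map_add, hw.2, hz.2, add_zero]

theorem smul_mem_exposedFace {w : F} (hw : w ∈ exposedFace A c p ν) {r : ℝ} (hr : 0 ≤ r) :
    r • w ∈ exposedFace A c p ν := by
  refine ⟨fun i hi => ?_, ?_⟩
  · rw [map_smul, smul_eq_mul]
    exact mul_nonpos_of_nonneg_of_nonpos hr (hw.1 i hi)
  · rw [map_smul, hw.2, smul_zero]

theorem sub_mem_activeCone {q : F} (hq : q ∈ polyhedron A c) : q - p ∈ activeCone A c p := by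
  intro i hi
  rw [map_sub, hi]
  exact sub_nonpos.2 (hq i)

variable [Finite ι]

/-- A polyhedron agrees near each of its points with the translated active cone. -/
theorem eventually_add_smul_mem_polyhedron (hp : p ∈ polyhedron A c) {w : F}
    (hw : w ∈ activeCone A c p) : ∀ᶠ t : ℝ in 𝓝[>] 0, p + t • w ∈ polyhedron A c := by
  refine eventually_all.2 fun i => ?_
  rcases (hp i).eq_or_lt with hi | hi
  · filter_upwards [self_mem_nhdsWithin] with t (ht : 0 < t)
    rw [map_add, map_smul, smul_eq_mul, hi]
    have := mul_nonpos_of_nonneg_of_nonpos ht.le (hw i hi)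
    linarith
  · have hcont : Continuous fun t : ℝ => A i (p + t • w) := by fun_prop
    have : ∀ᶠ t : ℝ in 𝓝 0, A i (p + t • w) < c i :=
      hcont.continuousAt.eventually_lt continuousAt_const (by simpa using hi)
    exact (this.filter_mono nhdsWithin_le_nhds).mono fun t ht => ht.le

/-- A direction that is admissible for the constraints on which `z` is tight enters the cone after
a large multiple of `z` is added. -/
theorem exists_add_smul_mem_activeCone {z w : F} (hz : z ∈ activeCone A c p)
    (hw : ∀ i, A i p = c i → A i z = 0 → A i w ≤ 0) :
    ∃ r : ℝ, 0 < r ∧ w + r • z ∈ activeCone A c p := by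
  have h : ∀ᶠ r : ℝ in atTop, w + r • z ∈ activeCone A c p := by
    refine eventually_all.2 fun i => ?_
    by_cases hi : A i p = c i
    · rcases (hz i hi).eq_or_lt with h0 | h0
      · refine Eventually.of_forall fun r _ => ?_
        rw [map_add, map_smul, h0, smul_zero, add_zero]
        exact hw i hi h0
      · filter_upwards [eventually_ge_atTop (A i w / -(A i z))] with r hr _
        rw [div_le_iff₀ (by linarith)] at hr
        rw [map_add, map_smul, smul_eq_mul]
        linarith
    · exact Eventually.of_forall fun r hi' => absurd hi' hi
  obtain ⟨r, hr, hr'⟩ := ((eventually_gt_atTop 0).and h).exists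
  exact ⟨r, hr, hr'⟩

/-- Existence of a relative interior point of the face: one that is tight only for the
constraints that are tight on the entire face. -/
theorem exists_tight_only_of_tight_on_exposedFace (A : ι → F →L[ℝ] ℝ) (c : ι → ℝ) (p : F)
    (ν : F →L[ℝ] ℝ) : ∃ z ∈ exposedFace A c p ν, ∀ i, A i p = c i → A i z = 0 →
      ∀ w ∈ exposedFace A c p ν, A i w = 0 := by
  classical
  have := Fintype.ofFinite ι
  have key : ∀ i, ∃ z ∈ exposedFace A c p ν, A i z = 0 → A i p = c i →
      ∀ w ∈ exposedFace A c p ν, A i w = 0 := by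
    intro i
    by_cases h : ∃ w ∈ exposedFace A c p ν, A i w ≠ 0
    · obtain ⟨w, hw, hne⟩ := h
      exact ⟨w, hw, fun h0 => absurd h0 hne⟩
    · push Not at h
      exact ⟨0, zero_mem_exposedFace, fun _ _ => h⟩
  choose z hz hz' using key
  refine ⟨∑ i, z i, ?_, fun i hi h0 => hz' i ?_ hi⟩
  · exact Finset.sum_induction z (· ∈ exposedFace A c p ν)
      (fun _ _ => add_mem_exposedFace) zero_mem_exposedFace fun i _ => hz i
  · rw [map_sum] at h0
    exact (Finset.sum_eq_zero_iff_of_nonpos fun j _ => (hz j).1 i hi).1 h0 i (Finset.mem_univ i)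

variable {κ : Type*} {l : Filter κ}

/-- Constraints inactive at `p` stay inactive nearby. -/
theorem eventually_active_imp_active {q : κ → F} (hp : p ∈ polyhedron A c)
    (hq : Tendsto q l (𝓝 p)) : ∀ᶠ k in l, ∀ i, A i (q k) = c i → A i p = c i := by
  refine eventually_all.2 fun i => ?_
  rcases (hp i).eq_or_lt with hi | hi
  · exact Eventually.of_forall fun _ _ => hi
  · have h : Tendsto (fun k => A i (q k)) l (𝓝 (A i p)) := ((A i).continuous.tendsto p).comp hq
    exact (h.eventually_lt_const hi).mono fun k hk h => absurd h hk.ne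

/-- The faces exposed by functionals close to `ν` are contained in the face exposed by `ν`. Every
exposed face is cut out of the cone by turning some of the constraints into equalities, so there
are finitely many of them; one that is not contained in the kernel of `ν` is not exposed by
functionals close to `ν`. -/
theorem eventually_exposedFace_subset {μ : κ → F →L[ℝ] ℝ}
    (hν : ∀ w ∈ activeCone A c p, ν w ≤ 0)
    (hμ : ∀ w, Tendsto (fun k => μ k w) l (𝓝 (ν w))) :
    ∀ᶠ k in l, (∀ w ∈ activeCone A c p, μ k w ≤ 0) →
      exposedFace A c p (μ k) ⊆ exposedFace A c p ν := by
  have h : ∀ᶠ k in l, ∀ J : Set ι,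
      (∀ w ∈ activeCone A c p, (∀ i ∈ J, A i w = 0) → μ k w = 0) →
      ∀ w ∈ activeCone A c p, (∀ i ∈ J, A i w = 0) → ν w = 0 := by
    refine eventually_all.2 fun J => ?_
    by_cases hJ : ∀ w ∈ activeCone A c p, (∀ i ∈ J, A i w = 0) → ν w = 0
    · exact Eventually.of_forall fun _ _ => hJ
    · push Not at hJ
      obtain ⟨w, hw, hwJ, hne⟩ := hJ
      have hlt : ν w < 0 := lt_of_le_of_ne (hν w hw) hne
      filter_upwards [(hμ w).eventually_lt_const hlt] with k hk hk'
      exact absurd (hk' w hw hwJ) hk.ne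
  filter_upwards [h] with k hk hneg w hw
  refine ⟨hw.1, hk {i | A i p = c i ∧ ∀ z ∈ exposedFace A c p (μ k), A i z = 0} ?_ w hw.1
    fun i hi => hi.2 w hw⟩
  intro t ht htJ
  obtain ⟨z, hz, hztight⟩ := exists_tight_only_of_tight_on_exposedFace A c p (μ k)
  -- The relative interior point `z` can be prolonged beyond itself in the direction `-t`.
  obtain ⟨r, -, hr⟩ := exists_add_smul_mem_activeCone (w := -t) hz.1 fun i hi h0 => by
    rw [map_neg, htJ i ⟨hi, hztight i hi h0⟩, neg_zero]
  have h1 := hneg _ hr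
  rw [map_add, map_smul, map_neg, hz.2, smul_zero, add_zero] at h1
  linarith [hneg t ht]

/-- Stability of exposed faces: near `(p, ν)` every one of them is contained in the span of the
face exposed by `ν` at `p`. -/
theorem eventually_exposedFace_subset_sub {q : κ → F} {μ : κ → F →L[ℝ] ℝ}
    (hp : p ∈ polyhedron A c) (hν : ∀ w ∈ activeCone A c p, ν w ≤ 0)
    (hq : Tendsto q l (𝓝 p)) (hμ : ∀ w, Tendsto (fun k => μ k w) l (𝓝 (ν w))) :
    ∀ᶠ k in l, q k ∈ polyhedron A c → (∀ w ∈ activeCone A c (q k), μ k w ≤ 0) →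
      exposedFace A c (q k) (μ k) ⊆ exposedFace A c p ν - exposedFace A c p ν := by
  filter_upwards [eventually_active_imp_active hp hq, eventually_exposedFace_subset hν hμ]
    with k hact hface hqk hneg w hw
  have hmono : activeCone A c p ⊆ activeCone A c (q k) := fun w hw i hi => hw i (hact i hi)
  replace hface := hface fun w hw => hneg w (hmono hw)
  set z := q k - p with hz
  have hzT : z ∈ activeCone A c p := sub_mem_activeCone hqk
  have hz0 : μ k z = 0 := by
    refine le_antisymm (hneg z (hmono hzT)) ?_
    have h1 := hneg _ (sub_mem_activeCone hp)
    rw [← neg_sub, map_neg] at h1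
    linarith
  obtain ⟨r, hr, hrT⟩ := exists_add_smul_mem_activeCone (w := w) hzT fun i hi h0 => by
    refine hw.1 i ?_
    rw [hz, map_sub] at h0
    linarith
  refine Set.mem_sub.2 ⟨w + r • z, hface ⟨hrT, ?_⟩, r • z, ?_, by abel⟩
  · rw [map_add, map_smul, hz0, hw.2, smul_zero, add_zero]
  · exact smul_mem_exposedFace (hface ⟨hzT, hz0⟩) hr.le

/-- Moving from `p` into the relative interior of the face exposed by `ν` keeps `ν` normal and
turns the exposed face into its linear span. -/
theorem exists_eventually_exposedFace_eq_sub (hp : p ∈ polyhedron A c)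
    (hν : ∀ w ∈ activeCone A c p, ν w ≤ 0) :
    ∃ z ∈ exposedFace A c p ν, ∀ᶠ t : ℝ in 𝓝[>] 0, p + t • z ∈ polyhedron A c ∧
      (∀ w ∈ activeCone A c (p + t • z), ν w ≤ 0) ∧
      exposedFace A c (p + t • z) ν = exposedFace A c p ν - exposedFace A c p ν := by
  obtain ⟨z, hz, htight⟩ := exists_tight_only_of_tight_on_exposedFace A c p ν
  have hlim : Tendsto (fun t : ℝ => p + t • z) (𝓝[>] 0) (𝓝 p) := by
    have hcont : Continuous fun t : ℝ => p + t • z := by fun_prop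
    simpa using (hcont.tendsto 0).mono_left nhdsWithin_le_nhds
  refine ⟨z, hz, ?_⟩
  filter_upwards [self_mem_nhdsWithin, eventually_add_smul_mem_polyhedron hp hz.1,
    eventually_active_imp_active hp hlim,
    eventually_exposedFace_subset_sub (μ := fun _ => ν) hp hν hlim fun _ => tendsto_const_nhds]
    with t (ht : 0 < t) hmem hact hsub
  have hact_iff : ∀ i, A i (p + t • z) = c i ↔ A i p = c i ∧ A i z = 0 := by
    refine fun i => ⟨fun h => ⟨hact i h, ?_⟩, fun h => ?_⟩
    · have h' := h
      rw [map_add, map_smul, hact i h, smul_eq_mul, add_eq_left] at h'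
      exact (mul_eq_zero.1 h').resolve_left ht.ne'
    · rw [map_add, map_smul, h.2, smul_zero, add_zero, h.1]
  have hneg : ∀ w ∈ activeCone A c (p + t • z), ν w ≤ 0 := by
    intro w hw
    obtain ⟨r, -, hr⟩ := exists_add_smul_mem_activeCone (w := w) hz.1 fun i hi h0 =>
      hw i ((hact_iff i).2 ⟨hi, h0⟩)
    have h1 := hν _ hr
    rwa [map_add, map_smul, hz.2, smul_zero, add_zero] at h1
  refine ⟨hmem, hneg, (hsub hmem hneg).antisymm ?_⟩
  rintro _ ⟨a, ha, b, hb, rfl⟩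
  refine ⟨fun i hi => ?_, ?_⟩
  · obtain ⟨hi, h0⟩ := (hact_iff i).1 hi
    simp only [map_sub, htight i hi h0 a ha, htight i hi h0 b hb, sub_zero, le_refl]
  · simp only [map_sub, ha.2, hb.2, sub_zero]

end Polyhedron

/-! ### Tangent and normal cones to polyhedra in `E × ℝ` -/

section NormalCone

variable {E ι : Type*} [NormedAddCommGroup E] [InnerProductSpace ℝ E]

/-- The functional on `E × ℝ` represented by the vector `(a, b)`. -/
noncomputable def pairing (a : E) (b : ℝ) : E × ℝ →L[ℝ] ℝ :=
  (innerSL ℝ a).coprod (b • ContinuousLinearMap.id ℝ ℝ)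

@[simp]
theorem pairing_apply (a : E) (b : ℝ) (p : E × ℝ) :
    pairing a b p = inner ℝ a p.1 + b * p.2 := by
  simp [pairing]

variable {A : ι → E × ℝ →L[ℝ] ℝ} {c : ι → ℝ} {p : E × ℝ}

theorem isClosed_activeCone : IsClosed (activeCone A c p) := by
  simp only [activeCone, Set.ofPred_forall]
  exact isClosed_iInter fun i => isClosed_iInter fun _ =>
    isClosed_le (A i).continuous continuous_const

variable [Finite ι]

theorem tangentCone_polyhedron (hp : p ∈ polyhedron A c) :
    tangentCone (polyhedron A c) p = activeCone A c p := by
  ext w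
  constructor
  · intro hw i hi
    by_contra! hpos
    have hU : {u | 0 < A i u} ∈ 𝓝 w :=
      (isOpen_lt continuous_const (A i).continuous).mem_nhds hpos
    obtain ⟨t, ⟨u, hu, hu'⟩, ht⟩ := ((hw _ hU).and_eventually self_mem_nhdsWithin).exists
    have h1 : A i (p + t • u) ≤ c i := hu i
    rw [map_add, map_smul, hi, smul_eq_mul] at h1
    have : 0 < t * A i u := mul_pos ht hu'
    linarith
  · intro hw U hU
    refine Eventually.frequently ?_
    filter_upwards [eventually_add_smul_mem_polyhedron hp hw] with t ht
    exact ⟨w, ht, mem_of_mem_nhds hU⟩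

/-- The limiting normal cone to a polyhedron is the polar of its tangent cone: near `p` the tangent
cones only grow, so the regular normal cones only shrink. -/
theorem mem_normalCone_polyhedron_iff (hp : p ∈ polyhedron A c) {a : E} {b : ℝ} :
    (a, b) ∈ normalCone (polyhedron A c) p ↔ ∀ w ∈ activeCone A c p, pairing a b w ≤ 0 := by
  constructor
  · intro h w hw
    by_contra! hpos
    rw [pairing_apply] at hpos
    have hU : {ν : E × ℝ | 0 < inner ℝ ν.1 w.1 + ν.2 * w.2} ∈ 𝓝 (a, b) :=
      (isOpen_lt continuous_const (by fun_prop)).mem_nhds hpos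
    obtain ⟨q, ⟨ν, ⟨hq, hν⟩, hν'⟩, hact⟩ :=
      ((h _ hU).and_eventually (eventually_active_imp_active hp tendsto_id)).exists
    rw [tangentCone_polyhedron hq] at hν
    exact (hν w fun i hi => hw i (hact i hi)).not_gt hν'
  · intro h U hU
    have hreg : (a, b) ∈ regularNormalCone (polyhedron A c) p :=
      ⟨hp, fun w hw => by simpa using h w (tangentCone_polyhedron hp ▸ hw)⟩
    exact fun hnot => hnot.self_of_nhds ⟨_, hreg, mem_of_mem_nhds hU⟩

end NormalCone

/-! ### First- and second-order variation of polyhedral functions -/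

theorem coe_le_sub_div_iff {y : EReal} {α r t : ℝ} (ht : 0 < t) :
    (r : EReal) ≤ (y - α) / (t : EReal) ↔ ((α + t * r : ℝ) : EReal) ≤ y := by
  rw [EReal.le_div_iff_mul_le (EReal.coe_pos.2 ht) (EReal.coe_ne_top t),
    EReal.le_sub_iff_add_le (.inl (EReal.coe_ne_bot α)) (.inl (EReal.coe_ne_top α)),
    ← EReal.coe_mul, ← EReal.coe_add, add_comm, mul_comm]

theorem sub_div_le_coe_iff {y : EReal} {α r t : ℝ} (ht : 0 < t) :
    (y - α) / (t : EReal) ≤ r ↔ y ≤ ((α + t * r : ℝ) : EReal) := by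
  rw [EReal.div_le_iff_le_mul (EReal.coe_pos.2 ht) (EReal.coe_ne_top t),
    EReal.sub_le_iff_le_add (.inl (EReal.coe_ne_bot α)) (.inl (EReal.coe_ne_top α)),
    ← EReal.coe_mul, ← EReal.coe_add, add_comm]

theorem sub_coe_sub_coe (y : EReal) (a b : ℝ) : y - a - b = y - ((a + b : ℝ) : EReal) := by
  induction y with
  | bot => simp
  | coe y => norm_cast; ring
  | top => rw [EReal.top_sub_coe, EReal.top_sub_coe, EReal.top_sub_coe]

theorem eventually_prod_pos {X : Type*} [TopologicalSpace X] (w : X) :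
    ∀ᶠ s : ℝ × X in 𝓝[>] (0 : ℝ) ×ˢ 𝓝 w, 0 < s.1 :=
  tendsto_fst.eventually self_mem_nhdsWithin

theorem frequently_prod_of_eventually {X : Type*} [TopologicalSpace X] {w : X} {P : ℝ × X → Prop}
    (h : ∀ᶠ t : ℝ in 𝓝[>] 0, P (t, w)) : ∃ᶠ s : ℝ × X in 𝓝[>] (0 : ℝ) ×ˢ 𝓝 w, P s := by
  have hlim : Tendsto (fun t : ℝ => (t, w)) (𝓝[>] 0) (𝓝[>] (0 : ℝ) ×ˢ 𝓝 w) :=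
    tendsto_id.prodMk tendsto_const_nhds
  exact hlim.frequently h.frequently

section PolyhedralFun

variable {E ι : Type*} [NormedAddCommGroup E] [InnerProductSpace ℝ E]
  {A : ι → E × ℝ →L[ℝ] ℝ} {c : ι → ℝ} {f : E → EReal} {x v : E} {α : ℝ}

theorem mem_polyhedron_iff (hf : epi f = polyhedron A c) {y : E} {r : ℝ} :
    (y, r) ∈ polyhedron A c ↔ f y ≤ r := by
  rw [← hf]; rfl

theorem exists_coe_of_mem_subdifferential (hv : v ∈ subdifferential f x) :
    ∃ α : ℝ, f x = α :=
  ⟨(f x).toReal, (EReal.coe_toReal hv.1 hv.2.1).symm⟩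

theorem coe_le_secondDiffQuot_iff (hx : f x = α) {r t : ℝ} (ht : 0 < t) {u : E} :
    (r : EReal) ≤ secondDiffQuot f x v t u ↔
      ((α + t * inner ℝ v u + t ^ 2 / 2 * r : ℝ) : EReal) ≤ f (x + t • u) := by
  rw [secondDiffQuot, hx, sub_coe_sub_coe, coe_le_sub_div_iff (by positivity)]

theorem secondDiffQuot_le_coe_iff (hx : f x = α) {r t : ℝ} (ht : 0 < t) {u : E} :
    secondDiffQuot f x v t u ≤ r ↔
      f (x + t • u) ≤ ((α + t * inner ℝ v u + t ^ 2 / 2 * r : ℝ) : EReal) := by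
  rw [secondDiffQuot, hx, sub_coe_sub_coe, sub_div_le_coe_iff (by positivity)]

theorem coe_le_of_notMem_activeCone (hf : epi f = polyhedron A c) {u : E} {β t : ℝ}
    (ht : 0 < t) (hu : (u, β) ∉ activeCone A c (x, α)) :
    ((α + t * β : ℝ) : EReal) ≤ f (x + t • u) := by
  by_contra! hlt
  refine hu fun i hi => ?_
  have h := sub_mem_activeCone (p := (x, α)) ((mem_polyhedron_iff hf).2 hlt.le) i hi
  have hsub : (x + t • u, α + t * β) - (x, α) = t • (u, β) := by
    ext <;> simp
  rw [hsub, map_smul, smul_eq_mul] at h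
  exact nonpos_of_mul_nonpos_right h ht

/-- Off the tangent cone to the epigraph, the first-order growth of `f` exceeds the given slope by
a uniform margin in nearby directions. -/
theorem exists_eventually_coe_le (hf : epi f = polyhedron A c) {w : E} {β : ℝ}
    (hw : (w, β) ∉ activeCone A c (x, α)) :
    ∃ ε : ℝ, 0 < ε ∧ ∀ᶠ s : ℝ × E in 𝓝[>] (0 : ℝ) ×ˢ 𝓝 w,
      ((α + s.1 * (β + ε) : ℝ) : EReal) ≤ f (x + s.1 • s.2) := by
  have hcont : Continuous fun s : ℝ × E => (s.2, β + s.1) := by fun_prop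
  have hmem : ∀ᶠ s : ℝ × E in 𝓝 ((0 : ℝ), w), (s.2, β + s.1) ∉ activeCone A c (x, α) :=
    hcont.continuousAt.eventually
      (isClosed_activeCone.isOpen_compl.mem_nhds (by simpa using hw))
  rw [nhds_prod_eq] at hmem
  obtain ⟨ε, hε, hε0⟩ :=
    ((hmem.curry.filter_mono nhdsWithin_le_nhds).and
      (self_mem_nhdsWithin : ∀ᶠ ε : ℝ in 𝓝[>] 0, ε ∈ Set.Ioi 0)).exists
  refine ⟨ε, hε0, ?_⟩
  filter_upwards [prod_mem_prod self_mem_nhdsWithin hε] with s hs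
  exact coe_le_of_notMem_activeCone hf hs.1 hs.2

variable [Finite ι]

theorem mem_subdifferential_iff (hf : epi f = polyhedron A c) (hx : f x = α) :
    v ∈ subdifferential f x ↔ ∀ w ∈ activeCone A c (x, α), pairing v (-1) w ≤ 0 := by
  rw [← mem_normalCone_polyhedron_iff ((mem_polyhedron_iff hf).2 hx.le), ← hf]
  simp [subdifferential, hx]

theorem coe_add_inner_le (hf : epi f = polyhedron A c) (hx : f x = α)
    (hv : v ∈ subdifferential f x) (y : E) : ((α + inner ℝ v (y - x) : ℝ) : EReal) ≤ f y := by
  rw [mem_subdifferential_iff hf hx] at hv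
  refine EReal.le_of_forall_lt_iff_le.1 fun r hr => ?_
  have h := hv _ (sub_mem_activeCone ((mem_polyhedron_iff hf).2 hr.le))
  simp only [pairing_apply, Prod.fst_sub, Prod.snd_sub] at h
  exact EReal.coe_le_coe_iff.2 (by linarith)

theorem eventually_le_coe (hf : epi f = polyhedron A c) (hx : f x = α) {w : E} {β : ℝ}
    (hw : (w, β) ∈ activeCone A c (x, α)) :
    ∀ᶠ t : ℝ in 𝓝[>] 0, f (x + t • w) ≤ ((α + t * β : ℝ) : EReal) := by
  filter_upwards [eventually_add_smul_mem_polyhedron ((mem_polyhedron_iff hf).2 hx.le) hw]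
    with t ht
  exact (mem_polyhedron_iff hf).1 (by simpa using ht)

theorem mem_criticalCone_iff (hf : epi f = polyhedron A c) (hx : f x = α)
    (hv : v ∈ subdifferential f x) {w : E} :
    w ∈ criticalCone f x v ↔ (w, inner ℝ v w) ∈ activeCone A c (x, α) := by
  rw [criticalCone, Set.mem_ofPred_eq, subderivative, hx]
  constructor
  · intro h
    by_contra hw
    obtain ⟨ε, hε, hev⟩ := exists_eventually_coe_le hf hw
    have hle : ((inner ℝ v w + ε : ℝ) : EReal) ≤ (inner ℝ v w : ℝ) := by
      rw [h]
      refine le_liminf_of_le (by isBoundedDefault) ?_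
      filter_upwards [hev, eventually_prod_pos w] with s hs hs0
      exact (coe_le_sub_div_iff hs0).2 hs
    rw [EReal.coe_le_coe_iff] at hle
    linarith
  · intro hw
    apply le_antisymm
    · have hlim : Tendsto (fun s : ℝ × E => ((inner ℝ v s.2 : ℝ) : EReal))
          (𝓝[>] (0 : ℝ) ×ˢ 𝓝 w) (𝓝 ((inner ℝ v w : ℝ) : EReal)) := by
        have hcont : Continuous fun u : E => ((inner ℝ v u : ℝ) : EReal) :=
          continuous_coe_real_ereal.comp (by fun_prop)
        exact (hcont.tendsto w).comp tendsto_snd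
      rw [← hlim.liminf_eq]
      refine liminf_le_liminf ?_
      filter_upwards [eventually_prod_pos w] with s hs0
      rw [coe_le_sub_div_iff hs0]
      simpa [inner_smul_right] using coe_add_inner_le hf hx hv (x + s.1 • s.2)
    · refine liminf_le_of_frequently_le' (frequently_prod_of_eventually ?_)
      filter_upwards [eventually_le_coe hf hx hw, self_mem_nhdsWithin] with t ht ht0
      exact (sub_div_le_coe_iff ht0).2 ht

/-- The second subderivative of a polyhedral function is the indicator of its critical cone: along
the cone the function is locally affine, and off it the first-order growth dominates. -/
theorem secondSubderivative_eq_indicatorFun (hf : epi f = polyhedron A c)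
    (hv : v ∈ subdifferential f x) :
    secondSubderivative f x v = indicatorFun (criticalCone f x v) := by
  obtain ⟨α, hx⟩ := exists_coe_of_mem_subdifferential hv
  funext w
  rw [secondSubderivative, indicatorFun]
  split_ifs with hw
  · rw [mem_criticalCone_iff hf hx hv] at hw
    apply le_antisymm
    · refine liminf_le_of_frequently_le' (frequently_prod_of_eventually ?_)
      filter_upwards [eventually_le_coe hf hx hw, self_mem_nhdsWithin] with t ht ht0
      exact (secondDiffQuot_le_coe_iff (r := 0) hx ht0).2 (by simpa using ht)
    · refine le_liminf_of_le (by isBoundedDefault) ?_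
      filter_upwards [eventually_prod_pos w] with s hs0
      refine (coe_le_secondDiffQuot_iff (r := 0) hx hs0).2 ?_
      simpa [inner_smul_right] using coe_add_inner_le hf hx hv (x + s.1 • s.2)
  · rw [mem_criticalCone_iff hf hx hv] at hw
    obtain ⟨ε, hε, hev⟩ := exists_eventually_coe_le hf hw
    refine (EReal.eq_top_iff_forall_lt _).2 fun r => lt_of_lt_of_le
      (EReal.coe_lt_coe_iff.2 (lt_add_one r)) (le_liminf_of_le (by isBoundedDefault) ?_)
    -- Half of the margin `ε` absorbs the variation of `⟨v, u⟩`, the other half beats `t ^ 2 / 2`.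
    have hinner : ∀ᶠ s : ℝ × E in 𝓝[>] (0 : ℝ) ×ˢ 𝓝 w,
        inner ℝ v s.2 < inner ℝ v w + ε / 2 := by
      have hcont : Continuous fun u : E => (inner ℝ v u : ℝ) := by fun_prop
      exact tendsto_snd.eventually ((hcont.tendsto w).eventually_lt_const (by linarith))
    have hsmall : ∀ᶠ s : ℝ × E in 𝓝[>] (0 : ℝ) ×ˢ 𝓝 w, s.1 / 2 * (r + 1) < ε / 2 := by
      have hcont : Continuous fun t : ℝ => t / 2 * (r + 1) := by fun_prop
      have h0 : ∀ᶠ t : ℝ in 𝓝 0, t / 2 * (r + 1) < ε / 2 :=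
        (hcont.tendsto 0).eventually_lt_const (by simpa using hε)
      exact tendsto_fst.eventually (h0.filter_mono nhdsWithin_le_nhds)
    filter_upwards [hev, eventually_prod_pos w, hinner, hsmall] with s hs hs0 h1 h2
    refine (coe_le_secondDiffQuot_iff hx hs0).2 (le_trans (EReal.coe_le_coe_iff.2 ?_) hs)
    have h3 : s.1 * (inner ℝ v s.2 + s.1 / 2 * (r + 1)) ≤ s.1 * (inner ℝ v w + ε) :=
      mul_le_mul_of_nonneg_left (by linarith) hs0.le
    linarith

end PolyhedralFun

/-! ### Critical cones at nearby points -/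

section CriticalCone

variable {E ι : Type*} [NormedAddCommGroup E] [InnerProductSpace ℝ E] [Finite ι]
  {A : ι → E × ℝ →L[ℝ] ℝ} {c : ι → ℝ} {f : E → EReal} {x v : E} {α : ℝ}

/-- The critical cone is the projection of the face of the tangent cone to the epigraph that the
normal `(v, -1)` exposes. -/
theorem criticalCone_eq_image (hf : epi f = polyhedron A c) (hx : f x = α)
    (hv : v ∈ subdifferential f x) :
    criticalCone f x v =
      LinearMap.fst ℝ E ℝ '' exposedFace A c (x, α) (pairing v (-1)) := by
  ext w
  rw [mem_criticalCone_iff hf hx hv]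
  constructor
  · intro hw
    exact ⟨(w, inner ℝ v w), ⟨hw, by simp⟩, rfl⟩
  · rintro ⟨⟨w, β⟩, ⟨hw, h0⟩, rfl⟩
    rw [pairing_apply] at h0
    have hβ : inner ℝ v w = β := by linarith
    simpa [hβ] using hw

theorem criticalCone_sub_eq_image (hf : epi f = polyhedron A c) (hx : f x = α)
    (hv : v ∈ subdifferential f x) :
    criticalCone f x v - criticalCone f x v = LinearMap.fst ℝ E ℝ ''
      (exposedFace A c (x, α) (pairing v (-1)) - exposedFace A c (x, α) (pairing v (-1))) := by
  rw [Set.image_sub, criticalCone_eq_image hf hx hv]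

theorem exists_submodule_coe_eq_criticalCone_sub (hf : epi f = polyhedron A c)
    (hv : v ∈ subdifferential f x) :
    ∃ S : Submodule ℝ E, (S : Set E) = criticalCone f x v - criticalCone f x v := by
  obtain ⟨α, hx⟩ := exists_coe_of_mem_subdifferential hv
  set K := exposedFace A c (x, α) (pairing v (-1)) with hK
  let S : Submodule ℝ (E × ℝ) :=
    { carrier := K - K
      zero_mem' := ⟨0, zero_mem_exposedFace, 0, zero_mem_exposedFace, sub_zero 0⟩
      add_mem' := by
        rintro _ _ ⟨a, ha, b, hb, rfl⟩ ⟨a', ha', b', hb', rfl⟩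
        exact ⟨a + a', add_mem_exposedFace ha ha', b + b', add_mem_exposedFace hb hb',
          add_sub_add_comm a a' b b'⟩
      smul_mem' := by
        rintro r _ ⟨a, ha, b, hb, rfl⟩
        rcases le_total 0 r with hr | hr
        · exact ⟨r • a, smul_mem_exposedFace ha hr, r • b, smul_mem_exposedFace hb hr,
            (smul_sub r a b).symm⟩
        · refine ⟨(-r) • b, smul_mem_exposedFace hb (neg_nonneg.2 hr), (-r) • a,
            smul_mem_exposedFace ha (neg_nonneg.2 hr), ?_⟩
          simp only [smul_sub, neg_smul]
          abel }
  refine ⟨S.map (LinearMap.fst ℝ E ℝ), ?_⟩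
  rw [criticalCone_sub_eq_image hf hx hv, Submodule.map_coe]
  rfl

/-- Convergence of `f (xs k)` along the graph of the subdifferential, from the subgradient
inequalities at the limit and at the points of the sequence. -/
theorem tendsto_value_of_mem_subdifferential (hf : epi f = polyhedron A c) (hx : f x = α)
    (hv : v ∈ subdifferential f x) {κ : Type*} {l : Filter κ} {xs vs : κ → E} {αs : κ → ℝ}
    (hxs : ∀ k, f (xs k) = αs k) (hvs : ∀ k, vs k ∈ subdifferential f (xs k))
    (hxlim : Tendsto xs l (𝓝 x)) (hvlim : Tendsto vs l (𝓝 v)) : Tendsto αs l (𝓝 α) := by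
  have hlow : Tendsto (fun k => α + inner ℝ v (xs k - x)) l (𝓝 α) := by
    simpa using ((tendsto_const_nhds (x := v)).inner (𝕜 := ℝ) (hxlim.sub_const x)).const_add α
  have hupp : Tendsto (fun k => α - inner ℝ (vs k) (x - xs k)) l (𝓝 α) := by
    simpa using (hvlim.inner (𝕜 := ℝ) (hxlim.const_sub x)).const_sub α
  refine tendsto_of_tendsto_of_tendsto_of_le_of_le hlow hupp (fun k => ?_) fun k => ?_
  · have h := coe_add_inner_le hf hx hv (xs k)
    rwa [hxs, EReal.coe_le_coe_iff] at h
  · have h := coe_add_inner_le hf (hxs k) (hvs k) x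
    rw [hx, EReal.coe_le_coe_iff] at h
    exact le_sub_iff_add_le.2 h

theorem eventually_criticalCone_subset_sub (hf : epi f = polyhedron A c)
    (hv : v ∈ subdifferential f x) {κ : Type*} {l : Filter κ} {xs vs : κ → E}
    (hvs : ∀ k, vs k ∈ subdifferential f (xs k))
    (hxlim : Tendsto xs l (𝓝 x)) (hvlim : Tendsto vs l (𝓝 v)) :
    ∀ᶠ k in l, criticalCone f (xs k) (vs k) ⊆ criticalCone f x v - criticalCone f x v := by
  obtain ⟨α, hx⟩ := exists_coe_of_mem_subdifferential hv
  choose αs hxs using fun k => exists_coe_of_mem_subdifferential (hvs k)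
  have hαlim := tendsto_value_of_mem_subdifferential hf hx hv hxs hvs hxlim hvlim
  have hμ : ∀ w : E × ℝ,
      Tendsto (fun k => pairing (vs k) (-1) w) l (𝓝 (pairing v (-1) w)) := by
    intro w
    simp only [pairing_apply]
    exact (hvlim.inner tendsto_const_nhds).add tendsto_const_nhds
  filter_upwards [eventually_exposedFace_subset_sub ((mem_polyhedron_iff hf).2 hx.le)
    ((mem_subdifferential_iff hf hx).1 hv) (hxlim.prodMk_nhds hαlim) hμ] with k hk
  rw [criticalCone_eq_image hf (hxs k) (hvs k), criticalCone_sub_eq_image hf hx hv]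
  exact Set.image_mono (hk ((mem_polyhedron_iff hf).2 (hxs k).le)
    ((mem_subdifferential_iff hf (hxs k)).1 (hvs k)))

/-- Moving `x` into the relative interior of the critical cone turns the critical cone into its
linear span. -/
theorem exists_seq_criticalCone_eq_sub (hf : epi f = polyhedron A c)
    (hv : v ∈ subdifferential f x) :
    ∃ xs : ℕ → E, Tendsto xs atTop (𝓝 x) ∧ ∀ k, v ∈ subdifferential f (xs k) ∧
      criticalCone f (xs k) v = criticalCone f x v - criticalCone f x v := by
  obtain ⟨α, hx⟩ := exists_coe_of_mem_subdifferential hv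
  obtain ⟨⟨w, β⟩, hz, hev⟩ := exists_eventually_exposedFace_eq_sub
    ((mem_polyhedron_iff hf).2 hx.le) ((mem_subdifferential_iff hf hx).1 hv)
  have hβ : inner ℝ v w = β := by
    have h0 := hz.2
    rw [pairing_apply] at h0
    linarith
  obtain ⟨ts, htlim, hts⟩ := exists_seq_forall_of_frequently hev.frequently
  refine ⟨fun k => x + ts k • w, ?_, fun k => ?_⟩
  · have hcont : Continuous fun t : ℝ => x + t • w := by fun_prop
    simpa [Function.comp_def] using
      (hcont.tendsto 0).comp (tendsto_nhds_of_tendsto_nhdsWithin htlim)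
  · obtain ⟨hmem, hneg, hface⟩ := hts k
    have hpt : (x, α) + ts k • (w, β) = (x + ts k • w, α + ts k * β) := by
      ext <;> simp
    rw [hpt] at hmem hneg hface
    -- The value at the new point is exact: the lower bound is the subgradient inequality at `x`.
    have hval : f (x + ts k • w) = ((α + ts k * β : ℝ) : EReal) := by
      refine le_antisymm ((mem_polyhedron_iff hf).1 hmem) ?_
      simpa [inner_smul_right, hβ] using coe_add_inner_le hf hx hv (x + ts k • w)
    have hvk : v ∈ subdifferential f (x + ts k • w) := (mem_subdifferential_iff hf hval).2 hneg
    exact ⟨hvk, by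
      rw [criticalCone_eq_image hf hval hvk, hface, criticalCone_sub_eq_image hf hx hv]⟩

end CriticalCone

/-! ### Indicators as generalized quadratic forms and epi-limits -/

section Indicator

theorem epi_indicatorFun {E : Type*} (C : Set E) : epi (indicatorFun C) = C ×ˢ Set.Ici 0 := by
  ext ⟨w, r⟩
  by_cases hw : w ∈ C
  · simp [epi, indicatorFun, hw]
  · simp [epi, indicatorFun, hw]

theorem le_of_epi_subset {E : Type*} {f g : E → EReal} (h : epi g ⊆ epi f) (w : E) : f w ≤ g w :=
  EReal.le_of_forall_lt_iff_le.1 fun r hr => h (show (w, r) ∈ epi g from hr.le)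

theorem isGQF_indicatorFun {E : Type*} [NormedAddCommGroup E] [InnerProductSpace ℝ E]
    (S : Submodule ℝ E) : IsGQF (indicatorFun (S : Set E)) := by
  have hdom : effDom (indicatorFun (S : Set E)) = S := by
    ext w
    by_cases hw : w ∈ S <;> simp [effDom, indicatorFun, hw]
  refine ⟨⟨fun w => ?_, ?_⟩, S, hdom, 0, by simp, fun w => ?_⟩
  · by_cases hw : w ∈ S <;> simp [indicatorFun, hw]
  · rw [hdom]
    exact ⟨0, S.zero_mem⟩
  · simp [indicatorFun]

theorem outerLimit_subset_of_eventually_subset {κ X : Type*} [TopologicalSpace X] {l : Filter κ}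
    {C : κ → Set X} {D : Set X} (hD : IsClosed D) (h : ∀ᶠ k in l, C k ⊆ D) :
    outerLimit l C ⊆ D := by
  intro w hw
  by_contra hwD
  obtain ⟨k, ⟨u, hu, hu'⟩, hk⟩ := ((hw Dᶜ (hD.isOpen_compl.mem_nhds hwD)).and_eventually h).exists
  exact hu' (hk hu)

theorem epiConverges_const {E : Type*} [NormedAddCommGroup E] {f : E → EReal}
    (hf : IsClosed (epi f)) :
    EpiConverges (fun _ => f) f := by
  have hin : epi f ⊆ innerLimit atTop (fun _ : ℕ => epi f) := fun w hw U hU =>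
    Eventually.of_forall fun _ => ⟨w, hw, mem_of_mem_nhds hU⟩
  have hio : innerLimit atTop (fun _ : ℕ => epi f) ⊆ outerLimit atTop (fun _ : ℕ => epi f) :=
    fun w hw U hU => (hw U hU).frequently
  have hout : outerLimit atTop (fun _ : ℕ => epi f) ⊆ epi f :=
    outerLimit_subset_of_eventually_subset hf (Eventually.of_forall fun _ => subset_rfl)
  exact ⟨(hio.trans hout).antisymm hin, hout.antisymm (hin.trans hio)⟩

end Indicator

end VarAnalysis

theorem proposition4p1 (n : ℕ) (θ : EuclideanSpace ℝ (Fin n) → EReal) (hθ : IsPolyhedralFun θ)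
    (xbar vbar : EuclideanSpace ℝ (Fin n)) (hv : vbar ∈ subdifferential θ xbar) :
    (∀ q ∈ quadBundle θ xbar vbar, ∀ w : EuclideanSpace ℝ (Fin n),
      indicatorFun (criticalCone θ xbar vbar - criticalCone θ xbar vbar) w ≤ q w) ∧
    indicatorFun (criticalCone θ xbar vbar - criticalCone θ xbar vbar) ∈
      quadBundle θ xbar vbar := by
  obtain ⟨m, a, b, c, hepi⟩ := hθ
  have hf : epi θ = polyhedron (fun i => pairing (a i) (b i)) c := by
    simp only [hepi, polyhedron, pairing_apply]
  obtain ⟨S, hS⟩ := exists_submodule_coe_eq_criticalCone_sub hf hv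
  have hclosed : IsClosed (epi (indicatorFun (S : Set (EuclideanSpace ℝ (Fin n))))) := by
    rw [epi_indicatorFun]
    exact S.closed_of_finiteDimensional.prod isClosed_Ici
  constructor
  · rintro q ⟨-, xs, vs, hvs, -, hxlim, hvlim, -, hout⟩ w
    rw [← hS]
    refine le_of_epi_subset ?_ w
    rw [← hout]
    refine outerLimit_subset_of_eventually_subset hclosed ?_
    filter_upwards [eventually_criticalCone_subset_sub hf hv hvs hxlim hvlim] with k hk
    rw [secondSubderivative_eq_indicatorFun hf (hvs k), epi_indicatorFun, epi_indicatorFun, hS]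
    exact Set.prod_mono hk subset_rfl
  · obtain ⟨xs, hxlim, hxs⟩ := exists_seq_criticalCone_eq_sub hf hv
    have hd2 : ∀ k, secondSubderivative θ (xs k) vbar =
        indicatorFun (S : Set (EuclideanSpace ℝ (Fin n))) := fun k => by
      rw [secondSubderivative_eq_indicatorFun hf (hxs k).1, (hxs k).2, hS]
    rw [← hS]
    refine ⟨isGQF_indicatorFun S, xs, fun _ => vbar, fun k => (hxs k).1, fun k => ?_, hxlim,
      tendsto_const_nhds, ?_⟩
    · rw [hd2]
      exact isGQF_indicatorFun S
    · simp only [hd2]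
      exact epiConverges_const hclosed
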